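/- Let $d\in\mathbb N$ and let $F_1,F_2\in M_d$ be hermitian complex $d\times d$ matrices. Let $$W_{F_1,F_2}=\{(\operatorname{tr}(F_1^*\rho),\operatorname{tr}(F_2^*\rho)) : \rho\in M_d,\ \rho\succeq 0,\ \operatorname{tr}\rho=1\}\subset\mathbb R^2$$ be their convex support (under $\mathbb R^2\cong\mathbb C$ this is the numerical range of $F_1+\mathrm i F_2$). Let $$V_{F_1,F_2}=\{(u_0:u_1:u_2)\in\mathbb P^2(\mathbb C) : \det(u_0\mathbf 1+u_1F_1+u_2F_2)=0\},$$ considered as a reduced curve (a point set), and let $V^\vee_{F_1,F_2}\subset\mathbb P^2(\mathbb C)^*$ be its projective dual, that is, the Zariski closure of the set of tangent lines to $V_{F_1,F_2}$ at its smooth points, where $(x_0:x_1:x_2)\in\mathbb P^2(\mathbb C)^*$ denotes the line $x_0u_0+x_1u_1+x_2u_2=0$. Let $$V^\vee_{\mathbb R,F_1,F_2}=\{(x_1,x_2)\in\mathbb R^2 : (1:x_1:x_2)\in V^\vee_{F_1,F_2}\}$$ be the boundary generating curve of $F_1+\mathrm i F_2$. Then $$W_{F_1,F_2}\subset\operatorname{conv}(V^\vee_{\mathbb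 R,F_1,F_2}).$$ -/

import Mathlib

open scoped ComplexOrder

noncomputable section

namespace Kippenhahn

/-- The state space of `M_d`: density matrices, i.e. positive semi-definite matrices of trace one. -/
def stateSpace (d : ℕ) : Set (Matrix (Fin d) (Fin d) ℂ) :=
  {ρ | ρ.trace = 1 ∧ ρ.PosSemidef}

/-- The convex support (joint algebraic numerical range) `W_{F_1,…,F_k} ⊆ ℝ^k`: all points
`(⟨F_1,ρ⟩,…,⟨F_k,ρ⟩)`, `ρ` a density matrix, where `⟨A,B⟩ = tr(A^* B)`.
(For hermitian `F_i` these numbers are real.) -/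
def convexSupport {k d : ℕ} (F : Fin k → Matrix (Fin d) (Fin d) ℂ) : Set (Fin k → ℝ) :=
  {x | ∃ ρ ∈ stateSpace d, ∀ i, (x i : ℂ) = ((F i).conjTranspose * ρ).trace}

/-- The linear pencil `L(u) = u_0 1 + u_1 F_1 + ⋯ + u_k F_k`. -/
def pencil {k d : ℕ} (F : Fin k → Matrix (Fin d) (Fin d) ℂ) (u : Fin (k + 1) → ℂ) :
    Matrix (Fin d) (Fin d) ℂ :=
  u 0 • (1 : Matrix (Fin d) (Fin d) ℂ) + ∑ i : Fin k, u i.succ • F i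

/-- Complex projective space `ℙ^k(ℂ)`. Its dual `ℙ^k(ℂ)^*` is modelled by the same type: the point
`(x_0 : … : x_k)` stands for the hyperplane `x_0 u_0 + ⋯ + x_k u_k = 0`. -/
abbrev ProjSpace (k : ℕ) : Type := Projectivization ℂ (Fin (k + 1) → ℂ)

/-- The (punctured) affine cone over a set of projective points: all their homogeneous
coordinate vectors. -/
def cone {k : ℕ} (S : Set (ProjSpace k)) : Set (Fin (k + 1) → ℂ) :=
  {u | ∃ h : u ≠ 0, Projectivization.mk ℂ u h ∈ S}

/-- The ideal of all polynomials that vanish on the cone over `S`. -/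
def projIdeal {k : ℕ} (S : Set (ProjSpace k)) : Ideal (MvPolynomial (Fin (k + 1)) ℂ) :=
  MvPolynomial.vanishingIdeal ℂ (cone S)

/-- The Zariski closure of a set of projective points. -/
def zariskiClosure {k : ℕ} (S : Set (ProjSpace k)) : Set (ProjSpace k) :=
  {p | ∀ f ∈ projIdeal S, MvPolynomial.eval p.rep f = 0}

/-- The determinantal variety `V = {(u_0 : … : u_k) | det L(u) = 0} ⊆ ℙ^k(ℂ)`, as a point set.
(`det L` is homogeneous, so the choice of coordinates does not matter.) -/
def detVariety {k d : ℕ} (F : Fin k → Matrix (Fin d) (Fin d) ℂ) : Set (ProjSpace k) :=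
  {p | (pencil F p.rep).det = 0}

/-- The linear subspace of `ℂ^{k+1}` whose projectivization is the embedded Zariski tangent space
of the (reduced) variety `X` at `p`: the common kernel of the differentials at `p` of all
polynomials in the ideal of `X`. -/
def tangentSpace {k : ℕ} (X : Set (ProjSpace k)) (p : ProjSpace k) :
    Submodule ℂ (Fin (k + 1) → ℂ) where
  carrier := {v | ∀ f ∈ projIdeal X,
    ∑ i, MvPolynomial.eval p.rep (MvPolynomial.pderiv i f) * v i = 0}
  zero_mem' := by simp
  add_mem' := by
    intro a b ha hb f hf
    simp only [Pi.add_apply, mul_add, Finset.sum_add_distrib, ha f hf, hb f hf, add_zero]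
  smul_mem' := by
    intro c a ha f hf
    have h := ha f hf
    simp only [Pi.smul_apply, smul_eq_mul, mul_left_comm _ c, ← Finset.mul_sum, h, mul_zero]

/-- Smooth points of a hypersurface `X ⊆ ℙ^k(ℂ)`: the projective tangent space has the dimension
`k - 1` of `X`, that is, the linear space above it has dimension `k`. -/
def IsSmoothPoint {k : ℕ} (X : Set (ProjSpace k)) (p : ProjSpace k) : Prop :=
  p ∈ X ∧ Module.finrank ℂ (tangentSpace X p) = k

/-- The hyperplane with coordinates `x` contains the tangent space of `X` at `p`. -/
def IsTangentAt {k : ℕ} (X : Set (ProjSpace k)) (p x : ProjSpace k) : Prop :=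
  ∀ v ∈ tangentSpace X p, ∑ i, x.rep i * v i = 0

/-- The projective dual of a hypersurface `X ⊆ ℙ^k(ℂ)`: the Zariski closure, in the dual projective
space, of the set of tangent hyperplanes of `X` at its smooth points. -/
def projectiveDual {k : ℕ} (X : Set (ProjSpace k)) : Set (ProjSpace k) :=
  zariskiClosure {x | ∃ p, IsSmoothPoint X p ∧ IsTangentAt X p x}

theorem cons_one_ne_zero {k : ℕ} (x : Fin k → ℝ) :
    (Fin.cons 1 (fun i => (x i : ℂ)) : Fin (k + 1) → ℂ) ≠ 0 := by
  intro h
  have h0 := congrFun h 0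
  simp at h0

/-- The boundary generating hypersurface (for `k = 2`: curve)
`{(x_1,…,x_k) ∈ ℝ^k | (1 : x_1 : … : x_k) ∈ V^∨}`. -/
def boundaryGenerating {k d : ℕ} (F : Fin k → Matrix (Fin d) (Fin d) ℂ) : Set (Fin k → ℝ) :=
  {x | Projectivization.mk ℂ (Fin.cons 1 (fun i => (x i : ℂ))) (cons_one_ne_zero x) ∈
    projectiveDual (detVariety F)}

end Kippenhahn

end

open scoped ComplexOrder

noncomputable section

namespace Kippenhahn

/-! Let h(u) be the maximum of u·y over y in W. If x attains it and comes from the state ρ, then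
h(u)1 - ∑ u_i F_i is positive semidefinite and annihilates ρ, so (-h(u), u) lies on det L = 0
(`det_pencil_eq_zero_of_isMax`). Let g be the reduced equation of that hypersurface. For u off a
proper algebraic set, all roots of g(·, u) are simple. Implicit differentiation then makes h
differentiable at u along the coordinate directions, and comparison with x forces its partial
derivatives to be the coordinates of x. Hence the gradient of g at (-h(u), u) is a nonzero multiple
of (1, x): the point is smooth with tangent hyperplane (1 : x), and x lies in the boundary
generating set B (`mem_boundaryGenerating_of_isMax`). Generic u suffice: a point of W outside the
convex hull of the compact set W ∩ B would be strictly separated from it by a generic functional,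
although that functional attains its maximum over W in B (`subset_convexHull_of_dense_maximizers`).
The argument works for every k ≥ 1. -/

/-! ### The reduced equation of det L = 0. -/

open Polynomial in
/-- The squarefree part of a monic polynomial over an integrally closed domain of characteristic
zero, together with a nonzero constant in the ideal generated by it and its derivative. -/
theorem exists_monic_squarefree_part {R : Type*} [CommRing R] [IsDomain R] [IsIntegrallyClosed R]
    [CharZero R] (p : R[X]) (hp : p.Monic) :
    ∃ g : R[X], (∀ (f : R[X]) (n : ℕ), p ∣ f ^ n → g ∣ f) ∧ (∃ m : ℕ, p ∣ g ^ m) ∧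
      ∃ (a b : R[X]) (r : R), r ≠ 0 ∧ a * g + b * derivative g = C r := by
  classical
  set K := FractionRing R
  have hinj : Function.Injective (algebraMap R K) := IsFractionRing.injective R K
  set q : K[X] := p.map (algebraMap R K) with hq
  have hqm : q.Monic := hp.map _
  have hq0 : q ≠ 0 := hqm.ne_zero
  -- Gauss's lemma: the radical over the fraction field descends to R, up to a constant.
  obtain ⟨g, hg⟩ := IsIntegrallyClosed.eq_map_mul_C_of_dvd K hp
    (UniqueFactorizationMonoid.radical_dvd_self (a := q))
  set ρ : K[X] := UniqueFactorizationMonoid.radical q with hρ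
  have hρ0 : ρ ≠ 0 := UniqueFactorizationMonoid.radical_ne_zero
  have hl0 : ρ.leadingCoeff ≠ 0 := leadingCoeff_ne_zero.mpr hρ0
  have hassoc : Associated (g.map (algebraMap R K)) ρ :=
    ⟨(isUnit_C.mpr hl0.isUnit).unit, hg⟩
  have hgm : g.Monic := by
    have h1 := congrArg leadingCoeff hg
    rw [leadingCoeff_mul, leadingCoeff_C] at h1
    exact monic_of_injective hinj (mul_right_cancel₀ hl0 (h1.trans (one_mul _).symm))
  refine ⟨g, fun f n h => ?_, ?_, ?_⟩
  · have h2 : q ∣ (f.map (algebraMap R K)) ^ n := by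
      rw [← Polynomial.map_pow]; exact Polynomial.map_dvd _ h
    have h3 := (UniqueFactorizationMonoid.exists_dvd_pow_iff_radical_dvd hq0).mp ⟨n, h2⟩
    exact (map_dvd_map _ hinj hgm).mp (hassoc.dvd.trans h3)
  · obtain ⟨m, hm⟩ := UniqueFactorizationMonoid.exists_dvd_radical_self_pow hq0
    refine ⟨m, (map_dvd_map _ hinj hp).mp ?_⟩
    rw [Polynomial.map_pow]
    exact hm.trans (pow_dvd_pow_of_dvd hassoc.symm.dvd m)
  · have hsq : Squarefree (g.map (algebraMap R K)) :=
      (UniqueFactorizationMonoid.squarefree_radical (a := q)).squarefree_of_dvd hassoc.dvd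
    have hsep := PerfectField.separable_iff_squarefree.mpr hsq
    obtain ⟨a, b, hab⟩ := hsep
    -- Clearing the denominators s, t of the Bézout coefficients yields the constant r = s t.
    obtain ⟨s, hs0, hs⟩ := IsLocalization.integerNormalization_spec (nonZeroDivisors R) a
    obtain ⟨t, ht0, ht⟩ := IsLocalization.integerNormalization_spec (nonZeroDivisors R) b
    refine ⟨C t * IsLocalization.integerNormalization (nonZeroDivisors R) a,
      C s * IsLocalization.integerNormalization (nonZeroDivisors R) b, s * t,
      mul_ne_zero (nonZeroDivisors.ne_zero hs0) (nonZeroDivisors.ne_zero ht0), ?_⟩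
    apply Polynomial.map_injective _ hinj
    rw [derivative_map] at hab
    have e1 : ∀ (c : R) (f : K[X]), c • f = C (algebraMap R K c) * f := fun c f => by
      rw [← algebraMap_smul K c f, smul_eq_C_mul]
    rw [Polynomial.map_add, Polynomial.map_mul, Polynomial.map_mul, Polynomial.map_mul,
      Polynomial.map_mul, hs, ht, map_C, map_C, map_C, e1, e1, map_mul, C_mul]
    linear_combination (C (algebraMap R K s) * C (algebraMap R K t)) * hab

theorem finSuccEquiv_pderiv_zero {R : Type*} [CommRing R] {k : ℕ}
    (f : MvPolynomial (Fin (k + 1)) R) :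
    MvPolynomial.finSuccEquiv R k (MvPolynomial.pderiv 0 f) =
      Polynomial.derivative (MvPolynomial.finSuccEquiv R k f) := by
  induction f using MvPolynomial.induction_on with
  | C a => simp [MvPolynomial.finSuccEquiv_apply]
  | add p q hp hq => simp [hp, hq]
  | mul_X p i hp =>
    rw [Derivation.leibniz, map_add, smul_eq_mul, smul_eq_mul, map_mul, map_mul, map_mul,
      Polynomial.derivative_mul, hp]
    refine Fin.cases ?_ (fun j => ?_) i
    · simp [MvPolynomial.finSuccEquiv_X_zero]; ring
    · simp [MvPolynomial.finSuccEquiv_X_succ, MvPolynomial.pderiv_X_of_ne (Fin.succ_ne_zero j)]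
      ring

/-- The reduced equation `g` of `det L = 0`: it divides every polynomial vanishing on the zero set,
and away from the zero set of a nonzero polynomial `r` in `u_1, …, u_k` its roots in `u_0` are
simple. -/
theorem exists_reduced_equation {k d : ℕ} (F : Fin k → Matrix (Fin d) (Fin d) ℂ) :
    ∃ (g : MvPolynomial (Fin (k + 1)) ℂ) (r : MvPolynomial (Fin k) ℂ), r ≠ 0 ∧
      (∀ u, MvPolynomial.eval u g = 0 ↔ (pencil F u).det = 0) ∧
      (∀ f, (∀ u, (pencil F u).det = 0 → MvPolynomial.eval u f = 0) → g ∣ f) ∧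
      ∀ (y : ℂ) (s : Fin k → ℂ), MvPolynomial.eval (Fin.cons y s) g = 0 →
        MvPolynomial.eval s r ≠ 0 →
        MvPolynomial.eval (Fin.cons y s) (MvPolynomial.pderiv 0 g) ≠ 0 := by
  set e := MvPolynomial.finSuccEquiv ℂ k
  -- The sign makes the characteristic polynomial det(T 1 - M) equal to det L, with T in the role of
  -- u_0; in particular det L is monic in u_0.
  set M : Matrix (Fin d) (Fin d) (MvPolynomial (Fin k) ℂ) :=
    -∑ i, (MvPolynomial.X i : MvPolynomial (Fin k) ℂ) •
      (F i).map (MvPolynomial.C : ℂ →+* MvPolynomial (Fin k) ℂ) with hM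
  have hdet : ∀ u, MvPolynomial.eval u (e.symm M.charpoly) = (pencil F u).det := by
    intro u
    obtain ⟨y, s, rfl⟩ : ∃ (y : ℂ) (s : Fin k → ℂ), u = Fin.cons y s :=
      ⟨u 0, Fin.tail u, (Fin.cons_self_tail u).symm⟩
    rw [MvPolynomial.eval_eq_eval_mv_eval', AlgEquiv.apply_symm_apply, ← Matrix.charpoly_map,
      Matrix.eval_charpoly]
    congr 1
    ext i j
    simp [pencil, hM, Matrix.sub_apply, Matrix.sum_apply, Matrix.scalar_apply, Matrix.diagonal,
      Matrix.one_apply]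
  obtain ⟨g, hg1, ⟨m, hm⟩, a, b, r, hr, hab⟩ :=
    exists_monic_squarefree_part M.charpoly M.charpoly_monic
  have hdvd : ∀ f, (∀ u, (pencil F u).det = 0 → MvPolynomial.eval u f = 0) → e.symm g ∣ f := by
    intro f hf
    -- Nullstellensatz: some power of f is divisible by det L.
    have h1 : f ∈ (Ideal.span {e.symm M.charpoly}).radical := by
      rw [← MvPolynomial.vanishingIdeal_zeroLocus_eq_radical (K := ℂ)]
      intro x hx
      rw [MvPolynomial.zeroLocus_span] at hx
      have h2 := hx _ rfl
      rw [MvPolynomial.aeval_eq_eval] at h2 ⊢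
      exact hf x ((hdet x).symm.trans h2)
    obtain ⟨n, hn⟩ := h1
    rw [Ideal.mem_span_singleton] at hn
    have h3 := hg1 (e f) n (by
      rw [← map_pow, ← e.apply_symm_apply M.charpoly]; exact map_dvd e hn)
    have h4 := map_dvd e.symm h3
    rwa [e.symm_apply_apply] at h4
  refine ⟨e.symm g, r, hr, fun u => ⟨fun h => ?_, fun h => ?_⟩, hdvd, fun y s hy hs h => ?_⟩
  · obtain ⟨c, hc⟩ := hdvd (e.symm M.charpoly) (fun u hu => (hdet u).trans hu)
    rw [← hdet, hc, map_mul, h, zero_mul]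
  · have h1 := map_dvd (MvPolynomial.eval u) (map_dvd e.symm hm)
    rw [hdet, h, zero_dvd_iff, map_pow, map_pow] at h1
    exact eq_zero_of_pow_eq_zero h1
  · rw [MvPolynomial.eval_eq_eval_mv_eval'] at hy h
    rw [finSuccEquiv_pderiv_zero] at h
    rw [AlgEquiv.apply_symm_apply] at hy h
    have h1 := congrArg (fun f => Polynomial.eval y (Polynomial.map (MvPolynomial.eval s) f)) hab
    simp only [Polynomial.map_add, Polynomial.map_mul, Polynomial.eval_add, Polynomial.eval_mul,
      hy, h, Polynomial.map_C, Polynomial.eval_C, mul_zero, add_zero] at h1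
    exact hs h1.symm

/-! ### Independence of the chosen homogeneous coordinates. -/

/-- The polynomial `f(c u)`. -/
def dilate {σ : Type*} (c : ℂ) : MvPolynomial σ ℂ →ₐ[ℂ] MvPolynomial σ ℂ :=
  MvPolynomial.aeval fun i => MvPolynomial.C c * MvPolynomial.X i

theorem eval_dilate {σ : Type*} (c : ℂ) (f : MvPolynomial σ ℂ) (u : σ → ℂ) :
    MvPolynomial.eval u (dilate c f) = MvPolynomial.eval (c • u) f := by
  induction f using MvPolynomial.induction_on with
  | C a => simp [dilate]
  | add p q hp hq => simp [hp, hq]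
  | mul_X p i hp => rw [map_mul, map_mul, hp]; simp [dilate]

theorem eval_pderiv_dilate {σ : Type*} (c : ℂ) (f : MvPolynomial σ ℂ) (u : σ → ℂ) (j : σ) :
    MvPolynomial.eval u (MvPolynomial.pderiv j (dilate c f)) =
      c * MvPolynomial.eval (c • u) (MvPolynomial.pderiv j f) := by
  classical
  induction f using MvPolynomial.induction_on with
  | C a => simp [dilate]
  | add p q hp hq => simp [hp, hq, mul_add]
  | mul_X p i hp =>
    have h1 : dilate c (MvPolynomial.X i) = MvPolynomial.C c * MvPolynomial.X i := by simp [dilate]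
    rw [map_mul, Derivation.leibniz, Derivation.leibniz, h1]
    simp only [smul_eq_mul, map_add, map_mul, hp, eval_dilate, Derivation.leibniz,
      MvPolynomial.pderiv_C, MvPolynomial.pderiv_X, MvPolynomial.eval_C, MvPolynomial.eval_X,
      Pi.smul_apply, mul_zero, add_zero]
    by_cases h : j = i
    · subst h; simp; ring
    · simp [Ne.symm h]; ring

theorem smul_mem_cone {k : ℕ} {S : Set (ProjSpace k)} {c : ℂ} (hc : c ≠ 0) {u : Fin (k + 1) → ℂ}
    (hu : u ∈ cone S) : c • u ∈ cone S := by
  obtain ⟨h0, h⟩ := hu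
  refine ⟨smul_ne_zero hc h0, ?_⟩
  have : Projectivization.mk ℂ (c • u) (smul_ne_zero hc h0) = Projectivization.mk ℂ u h0 :=
    (Projectivization.mk_eq_mk_iff' ℂ _ _ _ _).mpr ⟨c, rfl⟩
  rwa [this]

theorem mem_projIdeal {k : ℕ} {S : Set (ProjSpace k)} {f : MvPolynomial (Fin (k + 1)) ℂ} :
    f ∈ projIdeal S ↔ ∀ u ∈ cone S, MvPolynomial.eval u f = 0 := Iff.rfl

/-- Cones are stable under nonzero scaling. This invariance replaces homogeneity of the ideal when
passing from `rep` to arbitrary coordinates. -/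
theorem dilate_mem_projIdeal {k : ℕ} {S : Set (ProjSpace k)} {c : ℂ} (hc : c ≠ 0)
    {f : MvPolynomial (Fin (k + 1)) ℂ} (hf : f ∈ projIdeal S) : dilate c f ∈ projIdeal S := by
  rw [mem_projIdeal] at hf ⊢
  intro u hu
  rw [eval_dilate]
  exact hf _ (smul_mem_cone hc hu)

theorem exists_rep_mk {k : ℕ} (v : Fin (k + 1) → ℂ) (hv : v ≠ 0) :
    ∃ c : ℂ, c ≠ 0 ∧ (Projectivization.mk ℂ v hv).rep = c • v := by
  obtain ⟨a, ha⟩ := Projectivization.exists_smul_eq_mk_rep ℂ v hv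
  exact ⟨a, a.ne_zero, ha.symm⟩

theorem mk_mem_zariskiClosure {k : ℕ} {S : Set (ProjSpace k)} (v : Fin (k + 1) → ℂ) (hv : v ≠ 0) :
    Projectivization.mk ℂ v hv ∈ zariskiClosure S ↔
      ∀ f ∈ projIdeal S, MvPolynomial.eval v f = 0 := by
  obtain ⟨c, hc, h⟩ := exists_rep_mk v hv
  simp only [zariskiClosure, Set.mem_ofPred_eq, h]
  refine ⟨fun H f hf => ?_, fun H f hf => ?_⟩
  · have := H _ (dilate_mem_projIdeal (inv_ne_zero hc) hf)
    rwa [eval_dilate, smul_smul, inv_mul_cancel₀ hc, one_smul] at this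
  · rw [← eval_dilate]
    exact H _ (dilate_mem_projIdeal hc hf)

theorem mem_tangentSpace_mk {k : ℕ} {S : Set (ProjSpace k)} (v : Fin (k + 1) → ℂ) (hv : v ≠ 0)
    (w : Fin (k + 1) → ℂ) :
    w ∈ tangentSpace S (Projectivization.mk ℂ v hv) ↔
      ∀ f ∈ projIdeal S, ∑ i, MvPolynomial.eval v (MvPolynomial.pderiv i f) * w i = 0 := by
  obtain ⟨c, hc, h⟩ := exists_rep_mk v hv
  change (∀ f ∈ projIdeal S, ∑ i, MvPolynomial.eval (Projectivization.mk ℂ v hv).rep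
    (MvPolynomial.pderiv i f) * w i = 0) ↔ _
  rw [h]
  have key : ∀ f, ∑ i, MvPolynomial.eval v (MvPolynomial.pderiv i (dilate c f)) * w i =
      c * ∑ i, MvPolynomial.eval (c • v) (MvPolynomial.pderiv i f) * w i := fun f => by
    simp only [eval_pderiv_dilate, Finset.mul_sum, mul_assoc]
  refine ⟨fun H f hf => ?_, fun H f hf => ?_⟩
  · have h1 := H _ (dilate_mem_projIdeal (inv_ne_zero hc) hf)
    simp only [eval_pderiv_dilate, smul_smul, inv_mul_cancel₀ hc, one_smul, mul_assoc,
      ← Finset.mul_sum] at h1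
    exact (mul_eq_zero.mp h1).resolve_left (inv_ne_zero hc)
  · have h1 := H _ (dilate_mem_projIdeal hc hf)
    rw [key] at h1
    exact (mul_eq_zero.mp h1).resolve_left hc

theorem det_pencil_smul {k d : ℕ} (F : Fin k → Matrix (Fin d) (Fin d) ℂ) (c : ℂ)
    (u : Fin (k + 1) → ℂ) : (pencil F (c • u)).det = c ^ d * (pencil F u).det := by
  have : pencil F (c • u) = c • pencil F u := by
    simp [pencil, smul_smul, Finset.smul_sum]
  rw [this, Matrix.det_smul, Fintype.card_fin]

theorem mk_mem_detVariety {k d : ℕ} (F : Fin k → Matrix (Fin d) (Fin d) ℂ)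
    (v : Fin (k + 1) → ℂ) (hv : v ≠ 0) :
    Projectivization.mk ℂ v hv ∈ detVariety F ↔ (pencil F v).det = 0 := by
  obtain ⟨c, hc, h⟩ := exists_rep_mk v hv
  simp [detVariety, h, det_pencil_smul, hc]

theorem mem_cone_detVariety {k d : ℕ} (F : Fin k → Matrix (Fin d) (Fin d) ℂ)
    (v : Fin (k + 1) → ℂ) : v ∈ cone (detVariety F) ↔ v ≠ 0 ∧ (pencil F v).det = 0 := by
  simp [cone, mk_mem_detVariety]

/-! ### Tangent hyperplanes and the boundary generating set. -/

/-- If the gradient at `v` of the reduced equation of `det L = 0` is a nonzero multiple of `(1, x)`,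
then `x` lies on the boundary generating hypersurface. -/
theorem mem_boundaryGenerating_of_gradient {k d : ℕ} (F : Fin k → Matrix (Fin d) (Fin d) ℂ)
    (g : MvPolynomial (Fin (k + 1)) ℂ)
    (hg : ∀ u, MvPolynomial.eval u g = 0 ↔ (pencil F u).det = 0)
    (hdvd : ∀ f, (∀ u, (pencil F u).det = 0 → MvPolynomial.eval u f = 0) → g ∣ f)
    (v : Fin (k + 1) → ℂ) (hv : v ≠ 0) (hgv : MvPolynomial.eval v g = 0) (a : ℂ) (ha : a ≠ 0)
    (x : Fin k → ℝ)
    (hgrad : ∀ i, MvPolynomial.eval v (MvPolynomial.pderiv i g) =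
      a * (Fin.cons 1 (fun i => (x i : ℂ)) : Fin (k + 1) → ℂ) i) :
    x ∈ boundaryGenerating F := by
  set y : Fin (k + 1) → ℂ := Fin.cons 1 (fun i => (x i : ℂ)) with hy
  have hgI : g ∈ projIdeal (detVariety F) := fun u hu =>
    (hg u).mpr ((mem_cone_detVariety F u).mp hu).2
  have htan : ∀ w, w ∈ tangentSpace (detVariety F) (Projectivization.mk ℂ v hv) ↔
      ∑ i, y i * w i = 0 := by
    intro w
    rw [mem_tangentSpace_mk]
    constructor
    · intro H
      have h1 := H g hgI
      simp only [hgrad, mul_assoc, ← Finset.mul_sum] at h1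
      exact (mul_eq_zero.mp h1).resolve_left ha
    · intro H f hf
      -- The cone omits the origin, so vanishing of f at 0 is not given; multiplying by a coordinate
      -- with v_j ≠ 0 repairs this.
      obtain ⟨j, hj⟩ := Function.ne_iff.mp hv
      obtain ⟨q, hq⟩ := hdvd (MvPolynomial.X j * f) (fun u hu => by
        rw [map_mul, MvPolynomial.eval_X]
        by_cases h0 : u = 0
        · simp [h0]
        · rw [mem_projIdeal.mp hf u ((mem_cone_detVariety F u).mpr ⟨h0, hu⟩), mul_zero])
      have hfv : MvPolynomial.eval v f = 0 :=
        mem_projIdeal.mp hf v ((mem_cone_detVariety F v).mpr ⟨hv, (hg v).mp hgv⟩)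
      have hd : ∀ i, v j * MvPolynomial.eval v (MvPolynomial.pderiv i f) =
          MvPolynomial.eval v q * (a * y i) := by
        intro i
        -- In the derivative of X_j f = g q at v, the terms containing f(v) = 0 or g(v) = 0 drop
        -- out.
        have h2 := congrArg (fun p => MvPolynomial.eval v (MvPolynomial.pderiv i p)) hq
        simp only [Derivation.leibniz, smul_eq_mul, map_add, map_mul, MvPolynomial.eval_X, hfv,
          hgv, zero_mul, add_zero, zero_add, hgrad] at h2
        exact h2
      have h3 : v j * ∑ i, MvPolynomial.eval v (MvPolynomial.pderiv i f) * w i = 0 := by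
        simp only [Finset.mul_sum, ← mul_assoc, hd]
        simp only [mul_assoc, ← Finset.mul_sum, H, mul_zero]
      exact (mul_eq_zero.mp h3).resolve_left hj
  have hker : tangentSpace (detVariety F) (Projectivization.mk ℂ v hv) =
      LinearMap.ker (Fintype.linearCombination ℂ y) := by
    ext w
    rw [htan, LinearMap.mem_ker, Fintype.linearCombination_apply]
    simp only [smul_eq_mul, mul_comm]
  have hne : Fintype.linearCombination ℂ y ≠ 0 := fun h => by
    have h1 := LinearMap.congr_fun h (Pi.single 0 1)
    rw [Fintype.linearCombination_apply_single, LinearMap.zero_apply, one_smul] at h1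
    exact one_ne_zero h1
  have hrank : Module.finrank ℂ (tangentSpace (detVariety F) (Projectivization.mk ℂ v hv)) = k := by
    have := Module.Dual.finrank_ker_add_one_of_ne_zero hne
    rw [← hker, Module.finrank_fin_fun] at this
    omega
  refine (mk_mem_zariskiClosure _ _).mpr fun f hf => mem_projIdeal.mp hf y
    ⟨cons_one_ne_zero x, Projectivization.mk ℂ v hv, ⟨?_, hrank⟩, fun w hw => ?_⟩
  · exact (mk_mem_detVariety F v hv).mpr ((hg v).mp hgv)
  · obtain ⟨c, -, hc⟩ := exists_rep_mk y (cons_one_ne_zero x)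
    rw [hc]
    simp only [Pi.smul_apply, smul_eq_mul, mul_assoc, ← Finset.mul_sum, (htan w).mp hw, mul_zero]

theorem isClosed_boundaryGenerating {k d : ℕ} (F : Fin k → Matrix (Fin d) (Fin d) ℂ) :
    IsClosed (boundaryGenerating F) := by
  simp only [boundaryGenerating, projectiveDual, mk_mem_zariskiClosure, Set.ofPred_forall]
  refine isClosed_iInter fun f => isClosed_iInter fun _ => isClosed_eq ?_ continuous_const
  refine f.continuous_eval.comp (continuous_pi fun i => ?_)
  refine Fin.cases ?_ (fun j => ?_) i
  · simpa using continuous_const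
  · exact Complex.continuous_ofReal.comp (continuous_apply j)

/-! ### Convex hulls and generic functionals. -/

/-- In finite dimension the convex hull of a compact set is compact. -/
theorem isCompact_convexHull_of_isCompact {E : Type*} [NormedAddCommGroup E] [NormedSpace ℝ E]
    [FiniteDimensional ℝ E] {K : Set E} (hK : IsCompact K) : IsCompact (convexHull ℝ K) := by
  rcases K.eq_empty_or_nonempty with rfl | ⟨x₀, hx₀⟩
  · simp
  set n := Module.finrank ℝ E
  set Φ : (Fin (n + 1) → ℝ) × (Fin (n + 1) → E) → E := fun q => ∑ i, q.1 i • q.2 i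
  have hΦ : Continuous Φ := by fun_prop
  have himg : convexHull ℝ K =
      Φ '' (stdSimplex ℝ (Fin (n + 1)) ×ˢ Set.pi Set.univ fun _ => K) := by
    apply Set.Subset.antisymm
    · intro x hx
      -- Carathéodory: at most n + 1 points are needed. Unused slots get weight 0 and the dummy
      -- point x₀.
      obtain ⟨ι, _, z, w, hz, hind, hw, hw1, rfl⟩ := eq_pos_convex_span_of_mem_convexHull hx
      have hcard : Fintype.card ι ≤ Fintype.card (Fin (n + 1)) := by
        rw [Fintype.card_fin]
        exact hind.card_le_finrank_succ.trans
          (Nat.succ_le_succ (Submodule.finrank_le _))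
      obtain ⟨e⟩ := Function.Embedding.nonempty_of_card_le hcard
      have hext : ∀ i, i ∉ Set.range e → Function.extend e w 0 i = 0 := fun i hi =>
        Function.extend_apply' _ _ _ hi
      refine ⟨(Function.extend e w 0, Function.extend e z fun _ => x₀), ⟨⟨fun i => ?_, ?_⟩, ?_⟩, ?_⟩
      · by_cases hi : i ∈ Set.range e
        · obtain ⟨j, rfl⟩ := hi
          simpa [e.injective.extend_apply] using (hw j).le
        · exact (hext i hi).ge
      · rw [← hw1]
        refine (Fintype.sum_of_injective e e.injective _ _ hext fun j => ?_).symm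
        simp [e.injective.extend_apply]
      · intro i _
        by_cases hi : i ∈ Set.range e
        · obtain ⟨j, rfl⟩ := hi
          simpa [e.injective.extend_apply] using hz ⟨j, rfl⟩
        · simpa [Function.extend_apply' _ _ _ hi] using hx₀
      · refine (Fintype.sum_of_injective e e.injective _ _ (fun i hi => ?_) fun j => ?_).symm
        · simp [hext i hi]
        · simp [e.injective.extend_apply]
    · rintro _ ⟨⟨w, z⟩, ⟨⟨hw0, hw1⟩, hz⟩, rfl⟩
      exact (convex_convexHull ℝ K).sum_mem (fun i _ => hw0 i) hw1
        fun i _ => subset_convexHull ℝ K (hz i trivial)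
  rw [himg]
  exact ((isCompact_stdSimplex ℝ _).prod (isCompact_univ_pi fun _ => hK)).image hΦ

/-- A compact set is contained in the convex hull of a closed set `B` as soon as, for a dense set of
linear functionals, the maximum over the compact set is attained at a point of `B`. -/
theorem subset_convexHull_of_dense_maximizers {k : ℕ} {W B : Set (Fin k → ℝ)} (hW : IsCompact W)
    (hB : IsClosed B) {D : Set (Fin k → ℝ)} (hD : Dense D)
    (h : W.Nonempty → ∀ u ∈ D, ∃ x ∈ W ∩ B, ∀ y ∈ W, u ⬝ᵥ y ≤ u ⬝ᵥ x) : W ⊆ convexHull ℝ B := by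
  intro w hw
  by_contra hwB
  have hK : IsCompact (W ∩ B) := hW.inter_right hB
  have hwK : w ∉ convexHull ℝ (W ∩ B) := fun h1 =>
    hwB (convexHull_mono Set.inter_subset_right h1)
  obtain ⟨f, s, hfs, hsw⟩ := geometric_hahn_banach_closed_point (convex_convexHull ℝ (W ∩ B))
    (isCompact_convexHull_of_isCompact hK).isClosed hwK
  set u₀ : Fin k → ℝ := fun i => f (Pi.single i 1)
  have hf : ∀ x, f x = u₀ ⬝ᵥ x := fun x => by
    have := LinearMap.pi_apply_eq_sum_univ f.toLinearMap x
    simp only [ContinuousLinearMap.coe_coe, smul_eq_mul] at this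
    rw [this]
    refine Finset.sum_congr rfl fun i _ => ?_
    rw [mul_comm]
    congr 2
    ext j
    simp [Pi.single_apply, eq_comm]
  -- Strict separation from a compact set survives small perturbations of the functional.
  have hopen : ∀ᶠ u in nhds u₀, ∀ x ∈ W ∩ B, u ⬝ᵥ x < u ⬝ᵥ w := by
    refine hK.eventually_forall_of_forall_eventually fun x hx => ?_
    have hcont : Continuous fun z : (Fin k → ℝ) × (Fin k → ℝ) => z.1 ⬝ᵥ w - z.1 ⬝ᵥ z.2 := by
      unfold dotProduct; fun_prop
    have hpos : 0 < u₀ ⬝ᵥ w - u₀ ⬝ᵥ x := by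
      rw [← hf, ← hf]
      linarith [hfs x (subset_convexHull ℝ _ hx)]
    exact (hcont.continuousAt.eventually (lt_mem_nhds hpos)).mono fun z hz => sub_pos.mp hz
  obtain ⟨u, huD, hu⟩ := hD.inter_nhds_nonempty hopen
  obtain ⟨x, hx, hmax⟩ := h ⟨w, hw⟩ u huD
  exact (hu x hx).not_ge (hmax w hw)

/-- The real points at which a nonzero complex polynomial does not vanish are dense. -/
theorem dense_eval_ne_zero {k : ℕ} {r : MvPolynomial (Fin k) ℂ} (hr : r ≠ 0) :
    Dense {u : Fin k → ℝ | MvPolynomial.eval (fun i => (u i : ℂ)) r ≠ 0} := by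
  rw [Metric.dense_iff]
  intro u ε hε
  by_contra hne
  apply hr
  -- A polynomial vanishing on a product of infinite sets, here real intervals inside ℂ, is zero.
  refine MvPolynomial.funext_set (fun i => Complex.ofReal '' Metric.ball (u i) ε) (fun i => ?_) ?_
  · refine Set.Infinite.image Complex.ofReal_injective.injOn ?_
    rw [Real.ball_eq_Ioo]
    exact Set.Ioo_infinite (by linarith)
  · intro x hx
    choose v hv hvx using fun i => hx i trivial
    have hv' : v ∈ Metric.ball u ε := by
      rw [ball_pi _ hε]; exact fun i _ => hv i
    by_contra h0
    refine hne ⟨v, hv', ?_⟩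
    have : (fun i => (v i : ℂ)) = x := funext hvx
    simpa [this] using h0

/-! ### Compactness of the state space. -/

/-- Diagonal entries lie in [0, 1], and the 2 × 2 principal minors give |ρ_ij|² ≤ ρ_ii ρ_jj. -/
theorem norm_apply_le_one_of_mem_stateSpace {d : ℕ} {ρ : Matrix (Fin d) (Fin d) ℂ}
    (hρ : ρ ∈ stateSpace d) (i j : Fin d) : ‖ρ i j‖ ≤ 1 := by
  obtain ⟨htr, hpos⟩ := hρ
  have hdiag : ∀ i, (0 : ℝ) ≤ (ρ i i).re ∧ ρ i i = ((ρ i i).re : ℂ) := fun i => by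
    have h := Complex.nonneg_iff.mp (hpos.diag_nonneg (i := i))
    exact ⟨h.1, Complex.ext rfl h.2.symm⟩
  have hle : ∀ i, (ρ i i).re ≤ 1 := fun i => by
    have h1 : ∑ i, (ρ i i).re = 1 := by
      have := congrArg Complex.re htr
      simpa [Matrix.trace] using this
    rw [← h1]
    exact Finset.single_le_sum (f := fun i => (ρ i i).re) (fun i _ => (hdiag i).1)
      (Finset.mem_univ i)
  have hdet := (hpos.submatrix ![i, j]).det_nonneg
  rw [Matrix.det_fin_two] at hdet
  simp only [Matrix.submatrix_apply, Matrix.cons_val_zero, Matrix.cons_val_one] at hdet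
  have hji : ρ j i = star (ρ i j) := (hpos.isHermitian.apply j i).symm
  rw [hji, (hdiag i).2, (hdiag j).2] at hdet
  have h2 : ρ i j * star (ρ i j) = ((‖ρ i j‖ ^ 2 : ℝ) : ℂ) := by
    rw [Complex.star_def, Complex.mul_conj, Complex.normSq_eq_norm_sq]
  rw [h2] at hdet
  have h3 : 0 ≤ (ρ i i).re * (ρ j j).re - ‖ρ i j‖ ^ 2 := by exact_mod_cast hdet
  have h4 : (ρ i i).re * (ρ j j).re ≤ 1 :=
    mul_le_one₀ (hle i) (hdiag j).1 (hle j)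
  exact (sq_le_one_iff₀ (norm_nonneg _)).mp (by linarith)

theorem isCompact_stateSpace (d : ℕ) : IsCompact (stateSpace d) := by
  have hK : IsCompact (Set.pi Set.univ fun _ : Fin d => Set.pi Set.univ fun _ : Fin d =>
      Metric.closedBall (0 : ℂ) 1) :=
    isCompact_univ_pi fun _ => isCompact_univ_pi fun _ => isCompact_closedBall _ _
  refine IsCompact.of_isClosed_subset hK ?_ fun ρ hρ i _ j _ => by
    simpa using norm_apply_le_one_of_mem_stateSpace hρ i j
  have : stateSpace d = {ρ | ρ.trace = 1} ∩ ({ρ | ρ.conjTranspose = ρ} ∩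
      ⋂ x : Fin d → ℂ, {ρ | 0 ≤ star x ⬝ᵥ ρ.mulVec x}) := by
    ext ρ
    simp [stateSpace, Matrix.posSemidef_iff_dotProduct_mulVec, Matrix.IsHermitian]
  rw [this]
  refine (isClosed_eq (by fun_prop) continuous_const).inter
    ((isClosed_eq (by fun_prop) continuous_id).inter (isClosed_iInter fun x => ?_))
  refine isClosed_le continuous_const ?_
  fun_prop

/-! ### Support function and eigenvalues. -/

section

variable {k d : ℕ} {F : Fin k → Matrix (Fin d) (Fin d) ℂ}

/-- The point of the convex support given by a state. -/
def statePoint (F : Fin k → Matrix (Fin d) (Fin d) ℂ) (ρ : Matrix (Fin d) (Fin d) ℂ) : Fin k → ℝ :=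
  fun i => (((F i).conjTranspose * ρ).trace).re

theorem ofReal_statePoint (hF : ∀ i, (F i).IsHermitian) {ρ : Matrix (Fin d) (Fin d) ℂ}
    (hρ : ρ.IsHermitian) (i : Fin k) :
    (statePoint F ρ i : ℂ) = ((F i).conjTranspose * ρ).trace := by
  refine Complex.conj_eq_iff_re.mp ?_
  rw [← Complex.star_def, ← Matrix.trace_conjTranspose, Matrix.conjTranspose_mul,
    Matrix.conjTranspose_conjTranspose, hρ.eq, Matrix.trace_mul_comm, (hF i).eq]

theorem convexSupport_eq_image (hF : ∀ i, (F i).IsHermitian) :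
    convexSupport F = statePoint F '' stateSpace d := by
  ext x
  constructor
  · rintro ⟨ρ, hρ, h⟩
    exact ⟨ρ, hρ, funext fun i => by simp [statePoint, ← h i]⟩
  · rintro ⟨ρ, hρ, rfl⟩
    exact ⟨ρ, hρ, fun i => ofReal_statePoint hF hρ.2.isHermitian i⟩

theorem isCompact_convexSupport (hF : ∀ i, (F i).IsHermitian) : IsCompact (convexSupport F) := by
  rw [convexSupport_eq_image hF]
  refine (isCompact_stateSpace d).image (continuous_pi fun i => ?_)
  exact Complex.continuous_re.comp (by fun_prop)

/-- The hermitian matrix `c 1 - ∑ u_i F_i`. -/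
def shifted (F : Fin k → Matrix (Fin d) (Fin d) ℂ) (u : Fin k → ℝ) (c : ℝ) :
    Matrix (Fin d) (Fin d) ℂ :=
  (c : ℂ) • (1 : Matrix (Fin d) (Fin d) ℂ) - ∑ i, (u i : ℂ) • F i

theorem pencil_cons_neg (u : Fin k → ℝ) (c : ℝ) :
    pencil F (Fin.cons (-(c : ℂ)) fun i => (u i : ℂ)) = -shifted F u c := by
  simp [pencil, shifted]
  abel

theorem isHermitian_shifted (hF : ∀ i, (F i).IsHermitian) (u : Fin k → ℝ) (c : ℝ) :
    (shifted F u c).IsHermitian := by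
  simp only [Matrix.IsHermitian, shifted, Matrix.conjTranspose_sub, Matrix.conjTranspose_smul,
    Matrix.conjTranspose_one, Matrix.conjTranspose_sum, (hF _).eq, Complex.star_def,
    Complex.conj_ofReal]

theorem trace_shifted_mul (hF : ∀ i, (F i).IsHermitian) (u : Fin k → ℝ) (c : ℝ)
    {ρ : Matrix (Fin d) (Fin d) ℂ} (hρ : ρ ∈ stateSpace d) :
    (shifted F u c * ρ).trace = ((c - u ⬝ᵥ statePoint F ρ : ℝ) : ℂ) := by
  simp only [shifted, Matrix.sub_mul, Matrix.trace_sub, Matrix.smul_mul, Matrix.one_mul,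
    Matrix.trace_smul, hρ.1, Matrix.sum_mul, Matrix.trace_sum, dotProduct, Complex.ofReal_sub,
    Complex.ofReal_sum, Complex.ofReal_mul, ofReal_statePoint hF hρ.2.isHermitian, (hF _).eq,
    smul_eq_mul, mul_one]

/-- Tested on the pure states v v* / ‖v‖². -/
theorem posSemidef_of_trace_mul_state_nonneg {A : Matrix (Fin d) (Fin d) ℂ} (hA : A.IsHermitian)
    (h : ∀ ρ ∈ stateSpace d, 0 ≤ (A * ρ).trace) : A.PosSemidef := by
  refine Matrix.PosSemidef.of_dotProduct_mulVec_nonneg hA fun v => ?_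
  by_cases hv : v = 0
  · simp [hv]
  have hN : 0 < star v ⬝ᵥ v := Matrix.dotProduct_star_self_pos_iff.mpr hv
  have htr : ∀ B : Matrix (Fin d) (Fin d) ℂ,
      (B * Matrix.vecMulVec v (star v)).trace = star v ⬝ᵥ B.mulVec v := fun B => by
    rw [Matrix.mul_vecMulVec, Matrix.trace_vecMulVec, dotProduct_comm]
  have hstate : (star v ⬝ᵥ v)⁻¹ • Matrix.vecMulVec v (star v) ∈ stateSpace d := by
    refine ⟨?_, (Matrix.posSemidef_vecMulVec_self_star v).smul (inv_nonneg.mpr hN.le)⟩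
    rw [Matrix.trace_smul, Matrix.trace_vecMulVec, dotProduct_comm v, smul_eq_mul,
      inv_mul_cancel₀ hN.ne']
  have h1 := h _ hstate
  rw [Matrix.mul_smul, Matrix.trace_smul, htr, smul_eq_mul] at h1
  have h2 := mul_nonneg hN.le h1
  rwa [mul_inv_cancel_left₀ hN.ne'] at h2

open scoped MatrixOrder Matrix.Norms.L2Operator in
-- With A = C*C and B = E*E, the trace of AB is the squared Hilbert–Schmidt norm of CE*.
theorem mul_eq_zero_of_trace_mul_eq_zero {A B : Matrix (Fin d) (Fin d) ℂ} (hA : A.PosSemidef)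
    (hB : B.PosSemidef) (h : (A * B).trace = 0) : A * B = 0 := by
  obtain ⟨C, rfl⟩ := CStarAlgebra.nonneg_iff_eq_star_mul_self.mp hA.nonneg
  obtain ⟨E, rfl⟩ := CStarAlgebra.nonneg_iff_eq_star_mul_self.mp hB.nonneg
  simp only [Matrix.star_eq_conjTranspose] at h ⊢
  have h1 : ((C * E.conjTranspose).conjTranspose * (C * E.conjTranspose)).trace = 0 := by
    rw [← h, Matrix.conjTranspose_mul, Matrix.conjTranspose_conjTranspose, Matrix.mul_assoc,
      Matrix.trace_mul_comm]
    simp only [Matrix.mul_assoc]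
  rw [Matrix.trace_conjTranspose_mul_self_eq_zero_iff] at h1
  calc C.conjTranspose * C * (E.conjTranspose * E)
      = C.conjTranspose * (C * E.conjTranspose) * E := by simp only [Matrix.mul_assoc]
    _ = 0 := by rw [h1, Matrix.mul_zero, Matrix.zero_mul]

/-- The value of the support function of the convex support is an eigenvalue of `∑ u_i F_i`. -/
theorem det_pencil_eq_zero_of_isMax (hF : ∀ i, (F i).IsHermitian) (u x : Fin k → ℝ)
    (hx : x ∈ convexSupport F) (hmax : ∀ y ∈ convexSupport F, u ⬝ᵥ y ≤ u ⬝ᵥ x) :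
    (pencil F (Fin.cons (-((u ⬝ᵥ x : ℝ) : ℂ)) fun i => (u i : ℂ))).det = 0 := by
  rw [convexSupport_eq_image hF] at hx hmax
  obtain ⟨ρ, hρ, rfl⟩ := hx
  set c := u ⬝ᵥ statePoint F ρ
  have hpos : (shifted F u c).PosSemidef := by
    refine posSemidef_of_trace_mul_state_nonneg (isHermitian_shifted hF u c) fun σ hσ => ?_
    rw [trace_shifted_mul hF u c hσ]
    exact_mod_cast sub_nonneg.mpr (hmax _ ⟨σ, hσ, rfl⟩)
  have hzero : shifted F u c * ρ = 0 := by
    refine mul_eq_zero_of_trace_mul_eq_zero hpos hρ.2 ?_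
    rw [trace_shifted_mul hF u c hρ, sub_self, Complex.ofReal_zero]
  rw [pencil_cons_neg, Matrix.det_neg]
  refine mul_eq_zero_of_right _ ?_
  by_contra hdet
  have h1 : ρ = 0 := by
    rw [← Matrix.nonsing_inv_mul_cancel_left (shifted F u c) ρ (isUnit_iff_ne_zero.mpr hdet), hzero,
      Matrix.mul_zero]
  have h2 := hρ.1
  rw [h1, Matrix.trace_zero] at h2
  exact zero_ne_one h2

end

/-! ### Implicit differentiation along a root branch. -/

theorem hasFDerivAt_mvPolynomial_eval {σ : Type*} [Fintype σ] (g : MvPolynomial σ ℂ) (v : σ → ℂ) :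
    HasFDerivAt (fun u => MvPolynomial.eval u g)
      (∑ i, MvPolynomial.eval v (MvPolynomial.pderiv i g) •
        ContinuousLinearMap.proj (R := ℂ) (φ := fun _ : σ => ℂ) i) v := by
  classical
  induction g using MvPolynomial.induction_on with
  | C a =>
    simp only [MvPolynomial.eval_C]
    refine (hasFDerivAt_const (𝕜 := ℂ) a v).congr_fderiv ?_
    ext w
    simp
  | add p q hp hq =>
    simp only [map_add]
    refine (hp.add hq).congr_fderiv ?_
    ext w
    simp [add_mul, Finset.sum_add_distrib]
  | mul_X p i hp =>
    have h1 := hp.mul (hasFDerivAt_apply (𝕜 := ℂ) i v)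
    simp only [map_mul, MvPolynomial.eval_X]
    refine h1.congr_fderiv ?_
    ext w
    simp [MvPolynomial.pderiv_X, Pi.single_apply, add_mul, Finset.sum_add_distrib, Finset.mul_sum,
      mul_assoc, apply_ite (MvPolynomial.eval v)]

/-- A real Lipschitz branch of simple roots of a polynomial is differentiable, with the derivative
given by implicit differentiation. -/
theorem hasDerivAt_of_eval_eq_zero {k : ℕ} (g : MvPolynomial (Fin (k + 1)) ℂ) (y : ℝ → ℝ)
    (s w : Fin k → ℝ) (C : ℝ) (hC : ∀ t, |y t - y 0| ≤ C * |t|)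
    (hroot : ∀ t, MvPolynomial.eval (Fin.cons (y t : ℂ) fun i => ((s i + t * w i : ℝ) : ℂ)) g = 0)
    (ha : MvPolynomial.eval (Fin.cons (y 0 : ℂ) fun i => (s i : ℂ)) (MvPolynomial.pderiv 0 g) ≠ 0) :
    HasDerivAt (fun t => (y t : ℂ))
      (-(∑ i : Fin k, MvPolynomial.eval (Fin.cons (y 0 : ℂ) fun i => (s i : ℂ))
          (MvPolynomial.pderiv i.succ g) * (w i : ℂ)) /
        MvPolynomial.eval (Fin.cons (y 0 : ℂ) fun i => (s i : ℂ)) (MvPolynomial.pderiv 0 g)) 0 := by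
  set v : Fin (k + 1) → ℂ := Fin.cons (y 0 : ℂ) fun i => (s i : ℂ) with hv
  set a := MvPolynomial.eval v (MvPolynomial.pderiv 0 g)
  set b := ∑ i : Fin k, MvPolynomial.eval v (MvPolynomial.pderiv i.succ g) * (w i : ℂ)
  set P : ℝ → Fin (k + 1) → ℂ := fun t => Fin.cons (y t : ℂ) fun i => ((s i + t * w i : ℝ) : ℂ)
    with hP
  -- The Lipschitz bound turns an error o(P t - v) into o(t).
  have hbig : (fun t => P t - v) =O[nhds 0] fun t : ℝ => t := by
    rw [Asymptotics.isBigO_pi]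
    refine Fin.cases ?_ fun i => ?_
    · refine Asymptotics.IsBigO.of_bound C (Filter.Eventually.of_forall fun t => ?_)
      have : (P t - v) 0 = ((y t - y 0 : ℝ) : ℂ) := by simp [hP, hv]
      rw [this, Complex.norm_real, Real.norm_eq_abs, Real.norm_eq_abs]
      exact hC t
    · refine Asymptotics.IsBigO.of_bound |w i| (Filter.Eventually.of_forall fun t => ?_)
      have : (P t - v) i.succ = ((t * w i : ℝ) : ℂ) := by simp [hP, hv]
      rw [this, Complex.norm_real, Real.norm_eq_abs, Real.norm_eq_abs, abs_mul, mul_comm]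
  have htend : Filter.Tendsto P (nhds 0) (nhds v) := by
    have h0 : Filter.Tendsto (fun t => P t - v) (nhds 0) (nhds 0) :=
      hbig.trans_tendsto Filter.tendsto_id
    simpa using h0.add_const v
  have hlit := ((hasFDerivAt_mvPolynomial_eval g v).isLittleO.comp_tendsto htend).trans_isBigO hbig
  have hgv : MvPolynomial.eval v g = 0 := by simpa [hv] using hroot 0
  rw [hasDerivAt_iff_isLittleO]
  -- Since g vanishes at P t and at v, the expansion reads 0 = a (y t - y 0) + t b + o(t); it is
  -- solved for y t - y 0.
  have h2 := hlit.const_mul_left (-a⁻¹)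
  simp only [sub_zero]
  refine h2.congr_left fun t => ?_
  have h3 : MvPolynomial.eval (P t) g = 0 := hroot t
  have hL : ∀ z : Fin (k + 1) → ℂ, (∑ i, MvPolynomial.eval v (MvPolynomial.pderiv i g) •
      ContinuousLinearMap.proj (R := ℂ) (φ := fun _ : Fin (k + 1) => ℂ) i) z =
      a * z 0 + ∑ i : Fin k, MvPolynomial.eval v (MvPolynomial.pderiv i.succ g) * z i.succ :=
    fun z => by simp [Fin.sum_univ_succ, a]
  simp only [Function.comp_apply, h3, hgv, sub_zero, zero_sub, hL, Pi.sub_apply]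
  have h4 : ∀ i : Fin k, P t i.succ - v i.succ = t * w i := fun i => by simp [hP, hv]
  have h5 : P t 0 - v 0 = y t - y 0 := by simp [hP, hv]
  have h6 : ∑ i : Fin k, MvPolynomial.eval v (MvPolynomial.pderiv i.succ g) * ((t : ℂ) * w i) =
      t * b := by
    rw [Finset.mul_sum]
    exact Finset.sum_congr rfl fun i _ => by ring
  simp only [h4, h5, h6, Complex.real_smul]
  field_simp
  ring

/-! ### Maximisers in generic directions, and conclusion. -/

/-- In a direction `u` in which the reduced equation has only simple roots, every maximiser of
`u` over the convex support lies on the boundary generating hypersurface. -/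
theorem mem_boundaryGenerating_of_isMax {k d : ℕ} {F : Fin k → Matrix (Fin d) (Fin d) ℂ}
    (hF : ∀ i, (F i).IsHermitian) (g : MvPolynomial (Fin (k + 1)) ℂ)
    (hg : ∀ u, MvPolynomial.eval u g = 0 ↔ (pencil F u).det = 0)
    (hdvd : ∀ f, (∀ u, (pencil F u).det = 0 → MvPolynomial.eval u f = 0) → g ∣ f)
    (u : Fin k → ℝ) (hu : u ≠ 0)
    (hsimple : ∀ y : ℂ, MvPolynomial.eval (Fin.cons y fun i => (u i : ℂ)) g = 0 →
      MvPolynomial.eval (Fin.cons y fun i => (u i : ℂ)) (MvPolynomial.pderiv 0 g) ≠ 0)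
    (x : Fin k → ℝ) (hx : x ∈ convexSupport F)
    (hmax : ∀ y ∈ convexSupport F, u ⬝ᵥ y ≤ u ⬝ᵥ x) : x ∈ boundaryGenerating F := by
  have hW := isCompact_convexSupport hF
  have hcont : ∀ z : Fin k → ℝ, Continuous fun y : Fin k → ℝ => z ⬝ᵥ y := fun z => by
    unfold dotProduct; fun_prop
  have hroot := (hg _).mpr (det_pencil_eq_zero_of_isMax hF u x hx hmax)
  have ha := hsimple _ hroot
  refine mem_boundaryGenerating_of_gradient F g hg hdvd _ (fun h0 => hu ?_) hroot _ ha x ?_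
  · funext i
    have := congrFun h0 i.succ
    simpa using this
  refine Fin.cases (by simp) fun j => ?_
  set w : Fin k → ℝ := Pi.single j 1 with hw
  have hex : ∀ t : ℝ, ∃ z ∈ convexSupport F, ∀ y ∈ convexSupport F,
      (u + t • w) ⬝ᵥ y ≤ (u + t • w) ⬝ᵥ z := fun t =>
    hW.exists_isMaxOn ⟨x, hx⟩ (hcont _).continuousOn
  choose X hX hXmax using hex
  obtain ⟨C, hC⟩ := hW.exists_bound_of_continuousOn (hcont w).continuousOn
  -- Minus the support function along u + t w. The chosen X 0 may differ from x, but both attain the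
  -- same maximum.
  set y : ℝ → ℝ := fun t => -((u + t • w) ⬝ᵥ X t) with hy
  have hy0 : y 0 = -(u ⬝ᵥ x) := by
    have h1 := hmax _ (hX 0)
    have h2 := hXmax 0 x hx
    simp only [hy, zero_smul, add_zero] at h1 h2 ⊢
    linarith
  -- The point x competes in direction u + t w; in `hhigh`, X t competes in direction u.
  have hlow : ∀ t, y t - y 0 ≤ -(t * (w ⬝ᵥ x)) := fun t => by
    have h1 := hXmax t x hx
    rw [add_dotProduct, smul_dotProduct, smul_eq_mul] at h1
    rw [hy0]
    linarith
  have hhigh : ∀ t, -(t * (w ⬝ᵥ X t)) ≤ y t - y 0 := fun t => by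
    have h1 := hmax _ (hX t)
    have h2 : y t = -(u ⬝ᵥ X t + t * (w ⬝ᵥ X t)) := by
      simp only [hy, add_dotProduct, smul_dotProduct, smul_eq_mul]
    rw [hy0, h2]
    linarith
  have hlip : ∀ t, |y t - y 0| ≤ C * |t| := fun t => by
    have hb : ∀ z ∈ convexSupport F, |t * (w ⬝ᵥ z)| ≤ C * |t| := fun z hz => by
      rw [abs_mul, mul_comm]
      exact mul_le_mul_of_nonneg_right (hC z hz) (abs_nonneg t)
    have h1 := abs_le.mp (hb x hx)
    have h2 := abs_le.mp (hb _ (hX t))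
    exact abs_le.mpr ⟨by linarith [hhigh t], by linarith [hlow t]⟩
  have hroots : ∀ t : ℝ, MvPolynomial.eval
      (Fin.cons (y t : ℂ) fun i => ((u i + t * w i : ℝ) : ℂ)) g = 0 := fun t => by
    have h1 := (hg _).mpr (det_pencil_eq_zero_of_isMax hF (u + t • w) (X t) (hX t) (hXmax t))
    simpa [hy] using h1
  have hy0' : (y 0 : ℂ) = -((u ⬝ᵥ x : ℝ) : ℂ) := by rw [hy0, Complex.ofReal_neg]
  have hder := hasDerivAt_of_eval_eq_zero g y u w C hlip hroots (by rwa [hy0'])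
  rw [hy0'] at hder
  set v : Fin (k + 1) → ℂ := Fin.cons (-((u ⬝ᵥ x : ℝ) : ℂ)) fun i => (u i : ℂ)
  set a := MvPolynomial.eval v (MvPolynomial.pderiv 0 g)
  have hsum : ∑ i : Fin k, MvPolynomial.eval v (MvPolynomial.pderiv i.succ g) * (w i : ℂ) =
      MvPolynomial.eval v (MvPolynomial.pderiv j.succ g) := by
    rw [Finset.sum_eq_single j] <;> simp +contextual [hw]
  rw [hsum] at hder
  set b := MvPolynomial.eval v (MvPolynomial.pderiv j.succ g)
  have hre : HasDerivAt y (-b / a).re 0 := by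
    exact Complex.reCLM.hasFDerivAt.comp_hasDerivAt (0 : ℝ) hder
  have him : HasDerivAt (fun _ : ℝ => (0 : ℝ)) (-b / a).im 0 := by
    exact Complex.imCLM.hasFDerivAt.comp_hasDerivAt (0 : ℝ) hder
  have him0 : (-b / a).im = 0 := him.unique (hasDerivAt_const _ _)
  have hwx : w ⬝ᵥ x = x j := by simp [hw]
  have hre0 : (-b / a).re + x j = 0 := by
    -- By `hlow` this function is maximal at t = 0, which gives y'(0) = -x_j without uniqueness of
    -- the maximiser.
    have h1 : HasDerivAt (fun t => y t + t * x j) ((-b / a).re + x j) 0 := by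
      have h2 := hre.add ((hasDerivAt_id (0 : ℝ)).mul_const (x j))
      rw [one_mul] at h2
      exact h2
    refine IsLocalMax.hasDerivAt_eq_zero (Filter.Eventually.of_forall fun t => ?_) h1
    have := hlow t
    rw [hwx] at this
    simp only [zero_mul, add_zero]
    linarith
  have hq : -b / a = -(x j : ℂ) := by
    apply Complex.ext
    · rw [Complex.neg_re, Complex.ofReal_re]; linarith
    · rw [him0, Complex.neg_im, Complex.ofReal_im, neg_zero]
  rw [div_eq_iff ha] at hq
  rw [Fin.cons_succ]
  linear_combination -hq

theorem convexSupport_subset_convexHull_boundaryGenerating {k d : ℕ} [NeZero k]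
    (F : Fin k → Matrix (Fin d) (Fin d) ℂ) (hF : ∀ i, (F i).IsHermitian) :
    convexSupport F ⊆ convexHull ℝ (boundaryGenerating F) := by
  obtain ⟨g, r, hr, hg, hdvd, hsimple⟩ := exists_reduced_equation F
  refine subset_convexHull_of_dense_maximizers (isCompact_convexSupport hF)
    (isClosed_boundaryGenerating F)
    -- The extra factor X_0 excludes u = 0.
    (dense_eval_ne_zero (mul_ne_zero hr (MvPolynomial.X_ne_zero (0 : Fin k)))) ?_
  intro hne u hu
  change MvPolynomial.eval _ _ ≠ 0 at hu
  rw [map_mul, MvPolynomial.eval_X] at hu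
  have hcont : Continuous fun y : Fin k → ℝ => u ⬝ᵥ y := by unfold dotProduct; fun_prop
  obtain ⟨x, hx, hmax⟩ := (isCompact_convexSupport hF).exists_isMaxOn hne hcont.continuousOn
  refine ⟨x, ⟨hx, ?_⟩, hmax⟩
  refine mem_boundaryGenerating_of_isMax hF g hg hdvd u ?_
    (fun y hy => hsimple y _ hy (left_ne_zero_of_mul hu)) x hx hmax
  rintro rfl
  exact right_ne_zero_of_mul hu (by simp)

end Kippenhahn

end

theorem lemma2p1 (d : ℕ) (F₁ F₂ : Matrix (Fin d) (Fin d) ℂ)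
    (hF₁ : F₁.IsHermitian) (hF₂ : F₂.IsHermitian) :
    Kippenhahn.convexSupport ![F₁, F₂] ⊆
      convexHull ℝ (Kippenhahn.boundaryGenerating ![F₁, F₂]) := by
  refine Kippenhahn.convexSupport_subset_convexHull_boundaryGenerating _ fun i => ?_
  fin_cases i
  · exact hF₁
  · exact hF₂
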